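/- Throughout, a curve over a field $K$ is a nonsingular, projective, geometrically irreducible, one-dimensional variety defined over $K$, and a cover of curves over $K$ is a nonconstant separable morphism, defined over $K$, between curves over $K$. For a cover $\phi\colon X\to Y$ over $K$, let $\mathrm{Aut}(\phi)$ be the group (under composition) of those automorphisms $\mu$ of $X$ over $K$ with $\phi\circ\mu=\phi$, and let the monodromy group $\mathrm{Mon}(\phi)$ be the Galois group of the Galois closure of the extension of function fields $K(X)/K(Y)$, viewed as a group of permutations of the set of embeddings of $K(X)$ into a fixed algebraic closure of $K(Y)$ which are the identity on $K(Y)$. A Dedekind group is a group all of whose subgroups are normal. **Theorem 1.2.** Let $\theta\colon C_1\to D$ and $\rho\colon C\to C_1$ be covers of curves over a field $K$, and assume that the monodromy group $\mathrm{Mon}(\psi)$ of $\psi:=\theta\circ\rho$ has a transitive subgroup which is a Dedekind group. Then for every $\mu\in\mathrm{Aut}(\psi)$ there is a unique $\nu\in\mathrm{Aut}(\theta)$ with $\rho\circ\mu=\nu\circ\rho$. Moreover, the map $\mu\mapsto\nu$ is a homomorphism $\mathrm{Aut}(\psi)\to\mathrm{Aut}(\theta)$ with kernel $\mathrm{Aut}(\rho)$.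 -/

import Mathlib

open CategoryTheory AlgebraicGeometry

universe u

/-! ## Dedekind groups and monodromy of field extensions -/

/-- A Dedekind group: every subgroup is normal. -/
def IsDedekindGroup (A : Type*) [Group A] : Prop :=
  ∀ B : Subgroup A, B.Normal

namespace FieldExtension

variable (F E : Type*) [Field F] [Field E] [Algebra F E]

/-- The set of embeddings of `E` into the algebraic closure of `F` that are the identity on `F`. -/
abbrev Embeddings := E →ₐ[F] AlgebraicClosure F

/-- The normal closure of `E / F` inside the algebraic closure of `F`; it is the Galois closure
of `E / F` when that extension is separable. -/
noncomputable abbrev GaloisClosure : IntermediateField F (AlgebraicClosure F) :=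
  IntermediateField.normalClosure F E (AlgebraicClosure F)

/-- The Galois group of the Galois closure of `E / F`. -/
abbrev MonodromyGroup := GaloisClosure F E ≃ₐ[F] GaloisClosure F E

/-- The Galois group of the Galois closure permutes the embeddings of `E` by composition. (Every
embedding has its image in the Galois closure.) -/
noncomputable instance : MulAction (MonodromyGroup F E) (Embeddings F E) where
  smul σ e := normalClosure.algHomEquiv F E (AlgebraicClosure F)
    ((σ : GaloisClosure F E →ₐ[F] GaloisClosure F E).comp
      ((normalClosure.algHomEquiv F E (AlgebraicClosure F)).symm e))
  one_smul e := (normalClosure.algHomEquiv F E (AlgebraicClosure F)).apply_symm_apply e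
  mul_smul σ τ e := by
    change normalClosure.algHomEquiv F E (AlgebraicClosure F) _ =
      normalClosure.algHomEquiv F E (AlgebraicClosure F) (AlgHom.comp _
        ((normalClosure.algHomEquiv F E (AlgebraicClosure F)).symm
          (normalClosure.algHomEquiv F E (AlgebraicClosure F) _)))
    rw [Equiv.symm_apply_apply]
    rfl

/-- The monodromy group of `E / F`, as a group of permutations of the embeddings of `E`, has a
transitive Dedekind subgroup. -/
def HasTransitiveDedekindSubgroup : Prop :=
  ∃ A : Subgroup (MonodromyGroup F E),
    MulAction.IsPretransitive A (Embeddings F E) ∧ IsDedekindGroup A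

end FieldExtension

/-! ## Curves and covers -/

namespace CurveCover

attribute [local instance] MvPolynomial.gradedAlgebra

/-- Projective `n`-space over `K`. -/
noncomputable def projectiveSpace (K : Type u) [Field K] (n : ℕ) : Over (Spec (.of K)) :=
  Over.mk (Proj.toSpecZero (MvPolynomial.homogeneousSubmodule (Fin (n + 1)) K) ≫
    Spec.map (CommRingCat.ofHom
      (algebraMap K (MvPolynomial.homogeneousSubmodule (Fin (n + 1)) K 0))))

variable {K : Type u} [Field K]

theorem isProper_projectiveSpace (n : ℕ) : IsProper (projectiveSpace K n).hom := by
  let 𝒜 := MvPolynomial.homogeneousSubmodule (Fin (n + 1)) K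
  have : IsScalarTower K (𝒜 0) (MvPolynomial (Fin (n + 1)) K) :=
    ⟨fun a b x ↦ smul_mul_assoc a (b : MvPolynomial (Fin (n + 1)) K) x⟩
  have : Algebra.FiniteType (𝒜 0) (MvPolynomial (Fin (n + 1)) K) :=
    .of_restrictScalars_finiteType K _ _
  have : IsClosedImmersion (Spec.map (CommRingCat.ofHom (algebraMap K (𝒜 0)))) := by
    refine IsClosedImmersion.spec_of_surjective _ fun ⟨p, hp⟩ ↦ ?_
    have h0 : p.totalDegree = 0 := by
      simpa using (MvPolynomial.totalDegree_zero_iff_isHomogeneous (p := p)).mpr hp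
    exact ⟨p.coeff 0, Subtype.ext (MvPolynomial.totalDegree_eq_zero_iff_eq_C.mp h0).symm⟩
  exact inferInstanceAs (IsProper (Proj.toSpecZero 𝒜 ≫
    Spec.map (CommRingCat.ofHom (algebraMap K (𝒜 0)))))

/-- A curve over `K`: a nonsingular, projective, geometrically irreducible, one-dimensional variety
over `K`. -/
class IsCurve (X : Over (Spec (.of K))) : Prop where
  isIntegral : IsIntegral X.left
  projective : ∃ (n : ℕ) (i : X ⟶ projectiveSpace K n), IsClosedImmersion i.left
  geometricallyIrreducible : GeometricallyIrreducible X.hom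
  dimension_eq_one : topologicalKrullDim X.left = 1
  nonsingular : ∀ x : X.left, IsRegularLocalRing (X.left.presheaf.stalk x)

attribute [instance] IsCurve.isIntegral

/-- Curves are proper. -/
theorem IsCurve.isProper (X : Over (Spec (.of K))) [hX : IsCurve X] : IsProper X.hom := by
  obtain ⟨n, i, hi⟩ := hX.projective
  have := isProper_projectiveSpace (K := K) n
  rw [← Over.w i]
  infer_instance

/-- A nonconstant morphism of varieties. -/
def Nonconstant {X Y : Over (Spec (.of K))} (f : X ⟶ Y) : Prop :=
  ¬ ∃ y : Y.left, ∀ x : X.left, f.left x = y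

/-- A nonconstant morphism of curves maps the generic point to the generic point. -/
theorem Nonconstant.map_genericPoint {X Y : Over (Spec (.of K))} [IsCurve X] [IsCurve Y]
    {f : X ⟶ Y} (hf : Nonconstant f) :
    f.left (genericPoint X.left) = genericPoint Y.left := by
  by_contra hne
  refine hf ⟨f.left (genericPoint X.left), fun x ↦ ?_⟩
  by_contra hx
  set y := f.left (genericPoint X.left) with hy
  set z := f.left x with hz
  have hyz : y ⤳ z := (genericPoint_specializes x).map f.left.continuous
  have hηy : genericPoint Y.left ⤳ y := genericPoint_specializes y
  let c (t : Y.left) : TopologicalSpace.IrreducibleCloseds Y.left :=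
    ⟨closure {t}, isIrreducible_singleton.closure, isClosed_closure⟩
  have hlt {s t : Y.left} (h : s ⤳ t) (hst : t ≠ s) : c t < c s := by
    refine lt_of_le_of_ne (specializes_iff_closure_subset.mp h) fun he ↦ hst ?_
    have h' : t ⤳ s := specializes_iff_closure_subset.mpr
      (congrArg (fun a : TopologicalSpace.IrreducibleCloseds Y.left ↦ (a : Set Y.left)) he).ge
    exact (h'.antisymm h).eq
  let p : LTSeries (TopologicalSpace.IrreducibleCloseds Y.left) :=
    { length := 2
      toFun := ![c z, c y, c (genericPoint Y.left)]
      step := fun i ↦ by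
        fin_cases i
        · exact hlt hyz hx
        · exact hlt hηy hne }
  have hp : ((2 : ℕ) : WithBot ℕ∞) ≤ topologicalKrullDim Y.left :=
    Order.LTSeries.length_le_krullDim p
  rw [IsCurve.dimension_eq_one] at hp
  exact absurd hp (by decide)

/-- The inclusion of function fields `K(Y) ⟶ K(X)`, `g ↦ g ∘ f`, of a nonconstant morphism
`f : X ⟶ Y` of curves. -/
noncomputable def functionFieldMap {X Y : Over (Spec (.of K))} [IsCurve X] [IsCurve Y] (f : X ⟶ Y)
    (hf : Nonconstant f) : Y.left.functionField →+* X.left.functionField :=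
  (Y.left.presheaf.stalkSpecializes (specializes_of_eq hf.map_genericPoint) ≫
    f.left.stalkMap (genericPoint X.left)).hom

/-- A cover: a nonconstant separable morphism of curves. -/
class IsCover {X Y : Over (Spec (.of K))} [IsCurve X] [IsCurve Y] (f : X ⟶ Y) : Prop where
  nonconstant : Nonconstant f
  separable : letI := (functionFieldMap f nonconstant).toAlgebra
    Algebra.IsSeparable Y.left.functionField X.left.functionField

theorem Nonconstant.comp {X Y Z : Over (Spec (.of K))} [IsCurve X] [IsCurve Y] [IsCurve Z]
    {f : X ⟶ Y} {g : Y ⟶ Z} (hf : Nonconstant f) (hg : Nonconstant g) : Nonconstant (f ≫ g) := by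
  rintro ⟨z, hz⟩
  refine hg ⟨z, fun y ↦ ?_⟩
  have hX := IsCurve.isProper X
  have hY := IsCurve.isProper Y
  have hf' : IsProper f.left := by
    rw [← Over.w f] at hX
    exact .of_comp f.left Y.hom
  have hclosed : IsClosed (Set.range f.left) := f.left.isClosedMap.isClosed_range
  have hy : y ∈ Set.range f.left :=
    hclosed.stableUnderSpecialization (genericPoint_specializes y) ⟨_, hf.map_genericPoint⟩
  obtain ⟨x, rfl⟩ := hy
  simpa using hz x

theorem stalkMap_comp_of_eq {X Y Z : Scheme.{u}} (f : X ⟶ Y) (g : Y ⟶ Z) {x : X} {y : Y} {z : Z}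
    (hy : f x = y) (hz : g y = z) (hz' : (f ≫ g) x = z) :
    Z.presheaf.stalkSpecializes (specializes_of_eq hz') ≫ (f ≫ g).stalkMap x =
      (Z.presheaf.stalkSpecializes (specializes_of_eq hz) ≫ g.stalkMap y) ≫
        (Y.presheaf.stalkSpecializes (specializes_of_eq hy) ≫ f.stalkMap x) := by
  subst hy hz
  rw [Scheme.Hom.stalkMap_comp]
  erw [TopCat.Presheaf.stalkSpecializes_refl, TopCat.Presheaf.stalkSpecializes_refl,
    Category.id_comp]

/-- The composition of two covers is a cover. -/
instance IsCover.comp {X Y Z : Over (Spec (.of K))} [IsCurve X] [IsCurve Y] [IsCurve Z]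
    (f : X ⟶ Y) (g : Y ⟶ Z) [hf : IsCover f] [hg : IsCover g] : IsCover (f ≫ g) := by
  have hfg := hf.nonconstant.comp hg.nonconstant
  refine ⟨hfg, ?_⟩
  let := (functionFieldMap f hf.nonconstant).toAlgebra
  let := (functionFieldMap g hg.nonconstant).toAlgebra
  let := (functionFieldMap (f ≫ g) hfg).toAlgebra
  have : Algebra.IsSeparable Y.left.functionField X.left.functionField := hf.separable
  have : Algebra.IsSeparable Z.left.functionField Y.left.functionField := hg.separable
  have : IsScalarTower Z.left.functionField Y.left.functionField X.left.functionField := by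
    refine IsScalarTower.of_algebraMap_eq' ?_
    change functionFieldMap (f ≫ g) hfg =
      (functionFieldMap f hf.nonconstant).comp (functionFieldMap g hg.nonconstant)
    simp only [functionFieldMap, ← CommRingCat.hom_comp]
    exact congrArg CommRingCat.Hom.hom (stalkMap_comp_of_eq f.left g.left
      hf.nonconstant.map_genericPoint hg.nonconstant.map_genericPoint hfg.map_genericPoint)
  exact Algebra.IsSeparable.trans Z.left.functionField Y.left.functionField X.left.functionField

/-- The monodromy group of the cover `f : X ⟶ Y`, that is, the Galois group of the Galois closure
of `K(X) / K(Y)` acting on the embeddings of `K(X)` into an algebraic closure of `K(Y)`, has a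
transitive Dedekind subgroup. -/
def MonodromyHasTransitiveDedekindSubgroup {X Y : Over (Spec (.of K))} [IsCurve X] [IsCurve Y]
    (f : X ⟶ Y) [hf : IsCover f] : Prop :=
  letI := (functionFieldMap f hf.nonconstant).toAlgebra
  FieldExtension.HasTransitiveDedekindSubgroup Y.left.functionField X.left.functionField

/-- `Aut(f)`: the group of automorphisms `μ` of `X` over `K` with `f ∘ μ = f`. The product of the
group `Aut X` is composition: `(μ₁ * μ₂) x = μ₁ (μ₂ x)`. -/
def coverAut {X Y : Over (Spec (.of K))} (f : X ⟶ Y) : Subgroup (Aut X) where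
  carrier := {μ | μ.hom ≫ f = f}
  one_mem' := Category.id_comp f
  mul_mem' {μ₁ μ₂} (h₁ : μ₁.hom ≫ f = f) (h₂ : μ₂.hom ≫ f = f) :=
    show (μ₂.hom ≫ μ₁.hom) ≫ f = f by rw [Category.assoc, h₁, h₂]
  inv_mem' {μ} (h : μ.hom ≫ f = f) :=
    (Iso.inv_comp_eq (X := X) (Y := X) μ).mpr h.symm

end CurveCover

/-! ### Galois theory: Dedekind monodromy and intermediate fields -/

namespace FieldExtension

/-! Pullback along `μ` is an endomorphism `σ` of `K(C)` over `K(D)`; the point is that `σ` maps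
`K(C₁)` into itself. Let `A` be the transitive Dedekind subgroup, and let embeddings `e`, `e' = b •
e` of `K(C)` agree on `K(C₁)`. The elements of `A` fixing `e` on `K(C₁)` form a subgroup containing
`b`, normal since `A` is Dedekind. Write `e ∘ σ = a • e`. The Galois action commutes with
precomposition by `σ`, so `e' ∘ σ = b • a • e = a • (a⁻¹ * b * a) • e`, which agrees with `a • e = e
∘ σ` on `K(C₁)` (`comp_eqOn`). Thus all `K(C₁)`-embeddings agree on `σ (K(C₁))`, which by
separability lies in `K(C₁)` (`map_algebraMap_mem_range`).

The resulting map of function fields comes from a morphism `ν` because the local rings of a curve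
are valuation rings and curves are proper (`exists_comp_eq`). Since `ρ` is dominant, it can be
cancelled; this gives uniqueness, invertibility of `ν` (using `μ⁻¹`), multiplicativity and the
kernel. -/

theorem coe_smul_embedding {F E : Type*} [Field F] [Field E] [Algebra F E]
    (g : MonodromyGroup F E) (e : Embeddings F E) (x : E) :
    (g • e) x = g ((normalClosure.algHomEquiv F E (AlgebraicClosure F)).symm e x) :=
  rfl

/-- The action is by applying `g` to values, so only the value in the closure matters, not the
embedding or the point producing it. -/
theorem smul_embedding_congr {F E : Type*} [Field F] [Field E] [Algebra F E]
    (g : MonodromyGroup F E) {e e' : Embeddings F E} {x y : E} (h : e x = e' y) :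
    (g • e) x = (g • e') y := by
  rw [coe_smul_embedding, coe_smul_embedding]
  congr 2
  exact Subtype.ext h

theorem smul_embedding_comp {F E : Type*} [Field F] [Field E] [Algebra F E]
    (g : MonodromyGroup F E) (e : Embeddings F E) (σ : E →ₐ[F] E) :
    g • (e.comp σ : Embeddings F E) = (g • e).comp σ :=
  AlgHom.ext fun _ ↦ smul_embedding_congr g rfl

/-- Suppose that the monodromy group has a transitive Dedekind subgroup. If two embeddings agree on
a set `S`, then so do their compositions with an endomorphism of the extension. -/
theorem HasTransitiveDedekindSubgroup.comp_eqOn {F E : Type*} [Field F] [Field E] [Algebra F E]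
    (h : HasTransitiveDedekindSubgroup F E) (σ : E →ₐ[F] E) {S : Set E}
    {e e' : Embeddings F E} (hS : Set.EqOn e e' S) :
    Set.EqOn (e.comp σ) (e'.comp σ) S := by
  obtain ⟨A, hA, hD⟩ := h
  let B : Subgroup A :=
    { carrier := {a | Set.EqOn (a • e : Embeddings F E) e S}
      one_mem' := fun x _ ↦ by rw [one_smul]
      mul_mem' := fun {a b} ha hb x hx ↦ by
        rw [mul_smul]
        exact (smul_embedding_congr (a : MonodromyGroup F E) (hb hx)).trans (ha hx)
      inv_mem' := fun {a} ha x hx ↦ by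
        have := smul_embedding_congr ((a⁻¹ : A) : MonodromyGroup F E) (ha hx)
        change (a⁻¹ • a • e) x = (a⁻¹ • e) x at this
        rw [inv_smul_smul] at this
        exact this.symm }
  have hB : B.Normal := hD B
  obtain ⟨b, hb⟩ := MulAction.exists_smul_eq A e e'
  obtain ⟨a, ha⟩ := MulAction.exists_smul_eq A e (e.comp σ)
  have hbB : b ∈ B := fun x hx ↦ by rw [hb]; exact (hS hx).symm
  have hconj := hB.conj_mem b hbB a⁻¹
  intro x hx
  -- Here `b` moves past `σ`; normality then makes the conjugate fix `e` on `S`.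
  have h₁ : e'.comp σ = a • (a⁻¹ * b * a⁻¹⁻¹) • e := by
    rw [inv_inv, mul_smul, ha, ← mul_smul, mul_inv_cancel_left, ← hb]
    exact (smul_embedding_comp (b : MonodromyGroup F E) e σ).symm
  rw [h₁, ← ha]
  exact (smul_embedding_congr (a : MonodromyGroup F E) (hconj hx)).symm

/-- An element of a separable algebraic extension on which all embeddings into an algebraically
closed field agree lies in the base field. -/
theorem mem_range_algebraMap_of_forall_algHom_eq {L E : Type*} (Ω : Type*) [Field L] [Field E]
    [Field Ω] [Algebra L E] [Algebra L Ω] [IsAlgClosed Ω] [Algebra.IsSeparable L E] {x : E}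
    (h : ∀ e e' : E →ₐ[L] Ω, e x = e' x) : x ∈ (algebraMap L E).range := by
  -- The roots of the minimal polynomial are the images of `x`; separability makes their number the
  -- degree.
  have hsub : ((minpoly L x).rootSet Ω).Subsingleton := by
    rw [← Algebra.IsAlgebraic.range_eval_eq_rootSet_minpoly]
    rintro _ ⟨e, rfl⟩ _ ⟨e', rfl⟩
    exact h e e'
  rw [← minpoly.natDegree_eq_one_iff]
  refine le_antisymm ?_ (minpoly.natDegree_pos (Algebra.IsIntegral.isIntegral x))
  rw [← Polynomial.card_rootSet_eq_natDegree (K := Ω) (Algebra.IsSeparable.isSeparable L x)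
    (IsAlgClosed.splits _), Fintype.card_le_one_iff_subsingleton]
  exact hsub.coe_sort

/-- If the monodromy group of a separable extension has a transitive Dedekind subgroup, then
endomorphisms of the extension preserve all intermediate fields. -/
theorem HasTransitiveDedekindSubgroup.map_algebraMap_mem_range {F L E : Type*} [Field F] [Field L]
    [Field E] [Algebra F L] [Algebra L E] [Algebra F E] [IsScalarTower F L E]
    [Algebra.IsSeparable F E] (h : HasTransitiveDedekindSubgroup F E) (σ : E →ₐ[F] E) (x : L) :
    σ (algebraMap L E x) ∈ (algebraMap L E).range := by
  have : Algebra.IsSeparable L E := Algebra.isSeparable_tower_top_of_isSeparable F L E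
  -- Any embedding will do: it only serves to make the algebraic closure of `F` an extension of `L`.
  let e₀ : Embeddings F E := IsAlgClosed.lift
  let := (e₀.comp (IsScalarTower.toAlgHom F L E)).toRingHom.toAlgebra
  have : IsScalarTower F L (AlgebraicClosure F) :=
    .of_algebraMap_eq' (e₀.comp (IsScalarTower.toAlgHom F L E)).comp_algebraMap.symm
  refine mem_range_algebraMap_of_forall_algHom_eq (AlgebraicClosure F) fun e e' ↦ ?_
  refine h.comp_eqOn σ (S := Set.range (algebraMap L E)) (e := e.restrictScalars F)
    (e' := e'.restrictScalars F) ?_ ⟨x, rfl⟩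
  rintro _ ⟨y, rfl⟩
  exact (e.commutes y).trans (e'.commutes y).symm

end FieldExtension

/-! ### Regular local rings of dimension at most one -/

namespace IsRegularLocalRing

/-- A regular local domain of dimension at most one is a valuation ring. -/
theorem valuationRing_of_ringKrullDim_le_one (R : Type*) [CommRing R] [IsDomain R]
    [IsRegularLocalRing R] (h : ringKrullDim R ≤ 1) : ValuationRing R := by
  refine ((tfae_of_isNoetherianRing_of_isLocalRing_of_isDomain R).out 5 1).mp ?_
  rw [← (IsRegularLocalRing.iff_finrank_cotangentSpace R).mp ‹_›] at h
  exact_mod_cast h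

end IsRegularLocalRing

/-! ### Extending rational maps to proper schemes -/

namespace AlgebraicGeometry

/-- The spectrum of the stalk embeds topologically in `X`. -/
theorem ringKrullDim_stalk_le (X : Scheme.{u}) (x : X) :
    ringKrullDim (X.presheaf.stalk x) ≤ topologicalKrullDim X := by
  rw [← PrimeSpectrum.topologicalKrullDim_eq_ringKrullDim]
  exact (X.fromSpecStalk x).isEmbedding.isInducing.topologicalKrullDim_le

namespace Scheme.PartialMap

theorem SpecMap_stalkSpecializes_fromSpecStalkOfMem {X Y : Scheme.{u}} (f : X.PartialMap Y)
    {x y : X} (h : x ⤳ y) (hx : x ∈ f.domain) (hy : y ∈ f.domain) :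
    Spec.map (X.presheaf.stalkSpecializes h) ≫ f.fromSpecStalkOfMem hy =
      f.fromSpecStalkOfMem hx := by
  rw [fromSpecStalkOfMem, fromSpecStalkOfMem, ← Category.assoc]
  congr 1
  rw [← cancel_mono f.domain.ι, Category.assoc, Scheme.Opens.fromSpecStalkOfMem_ι,
    Scheme.Opens.fromSpecStalkOfMem_ι, Scheme.SpecMap_stalkSpecializes_fromSpecStalk]

end Scheme.PartialMap

/-- The inclusion of the generic point of an integral scheme is dominant. -/
instance isDominant_fromSpecStalk_genericPoint (X : Scheme.{u}) [IsIntegral X] :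
    IsDominant (X.fromSpecStalk (genericPoint X)) := by
  refine ⟨dense_iff_closure_eq.mpr (Set.univ_subset_iff.mp ?_)⟩
  rw [← genericPoint_closure (α := X)]
  exact closure_mono (Set.singleton_subset_iff.mpr ⟨_, X.fromSpecStalk_closedPoint⟩)

/-- The existence part of the valuative criterion, with the valuation ring and its field of
fractions given as objects of the category of rings. -/
theorem exists_lift_of_valuationRing {X Y : Scheme.{u}} (f : X ⟶ Y) [UniversallyClosed f]
    {A B : CommRingCat.{u}} [IsDomain A] [ValuationRing A] (hB : IsField B) [Algebra A B]
    [IsFractionRing A B] (i₁ : Spec B ⟶ X) (i₂ : Spec A ⟶ Y)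
    (h : i₁ ≫ f = Spec.map (CommRingCat.ofHom (algebraMap A B)) ≫ i₂) :
    ∃ φ : Spec A ⟶ X,
      Spec.map (CommRingCat.ofHom (algebraMap A B)) ≫ φ = i₁ ∧ φ ≫ f = i₂ := by
  obtain ⟨A⟩ := A
  obtain ⟨B⟩ := B
  let := hB.toField
  have hv : UniversallyClosed f := ‹_›
  rw [UniversallyClosed.eq_valuativeCriterion] at hv
  obtain ⟨⟨φ, h₁, h₂⟩⟩ := (hv.1 { R := A, K := B, i₁ := i₁, i₂ := i₂, commSq := ⟨h⟩ }).exists_lift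
  exact ⟨φ, h₁, h₂⟩

/-- A rational map between schemes over `S` from an integral scheme all of whose local rings are
valuation rings to a proper `S`-scheme is a morphism. -/
theorem exists_hom_of_fromFunctionField {X Y S : Scheme.{u}} (sX : X ⟶ S) (sY : Y ⟶ S)
    [IsIntegral X] [IsProper sY] [S.IsSeparated] (hX : ∀ x : X, ValuationRing (X.presheaf.stalk x))
    (g : Spec X.functionField ⟶ Y) (hg : g ≫ sY = X.fromSpecStalk (genericPoint X) ≫ sX) :
    ∃ f : X ⟶ Y, X.fromSpecStalk (genericPoint X) ≫ f = g := by
  have : Y.IsSeparated := by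
    rw [Scheme.isSeparated_iff, ← Limits.terminal.comp_from sY]
    infer_instance
  let F : X ⤏ Y := .ofFunctionField sX sY g hg
  have hF : F.fromFunctionField = g := Scheme.RationalMap.fromFunctionField_ofFunctionField ..
  have hdom : F.domain = ⊤ := by
    refine top_le_iff.mp fun x _ ↦ Scheme.RationalMap.mem_domain.mpr ?_
    have := hX x
    have hsp := genericPoint_specializes x
    obtain ⟨φ, hφ₁, hφ₂⟩ := exists_lift_of_valuationRing sY
      (Field.toIsField X.functionField) g (X.fromSpecStalk x ≫ sX) (by
        rw [hg, ← X.SpecMap_stalkSpecializes_fromSpecStalk hsp, Category.assoc]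
        rfl)
    -- The valuative lift at `x` spreads out to a neighbourhood of `x`; it represents `F` because
    -- both agree at the generic point.
    let f := Scheme.PartialMap.ofFromSpecStalk sX sY φ hφ₂
    have hxf := Scheme.PartialMap.mem_domain_ofFromSpecStalk sX sY φ hφ₂
    refine ⟨f, hxf, Scheme.RationalMap.eq_of_fromFunctionField_eq _ _ ?_⟩
    rw [hF, ← hφ₁, Scheme.RationalMap.fromFunctionField_toRationalMap]
    refine (f.SpecMap_stalkSpecializes_fromSpecStalkOfMem hsp _ hxf).symm.trans ?_
    rw [Scheme.PartialMap.fromSpecStalkOfMem_ofFromSpecStalk]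
    rfl
  have hF' := F.toRationalMap_toPartialMap
  generalize hP : F.toPartialMap = P at hF'
  have hPdom : P.domain = ⊤ := by rw [← hP]; exact hdom
  obtain ⟨U, hU, p⟩ := P
  obtain rfl : U = ⊤ := hPdom
  refine ⟨X.topIso.inv ≫ p, ?_⟩
  rw [← hF, ← hF', Scheme.RationalMap.fromFunctionField_toRationalMap]
  change _ = Scheme.Opens.fromSpecStalkOfMem _ _ _ ≫ p
  rw [← Category.assoc]
  congr 1
  rw [Iso.comp_inv_eq]
  exact (Scheme.Opens.fromSpecStalkOfMem_ι ..).symm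

end AlgebraicGeometry

/-! ### Morphisms of curves from maps of function fields -/

namespace CurveCover

variable {K : Type u} [Field K]

theorem functionFieldMap_comp {X Y Z : Over (Spec (.of K))} [IsCurve X] [IsCurve Y] [IsCurve Z]
    (f : X ⟶ Y) (g : Y ⟶ Z) (hf : Nonconstant f) (hg : Nonconstant g) (hfg : Nonconstant (f ≫ g)) :
    functionFieldMap (f ≫ g) hfg = (functionFieldMap f hf).comp (functionFieldMap g hg) := by
  simp only [functionFieldMap, ← CommRingCat.hom_comp]
  exact congrArg CommRingCat.Hom.hom (stalkMap_comp_of_eq f.left g.left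
    hf.map_genericPoint hg.map_genericPoint hfg.map_genericPoint)

theorem SpecMap_functionFieldMap_fromSpecStalk {X Y : Over (Spec (.of K))} [IsCurve X] [IsCurve Y]
    (f : X ⟶ Y) (hf : Nonconstant f) :
    Spec.map (CommRingCat.ofHom (functionFieldMap f hf)) ≫
        Y.left.fromSpecStalk (genericPoint Y.left) =
      X.left.fromSpecStalk (genericPoint X.left) ≫ f.left := by
  rw [functionFieldMap, CommRingCat.ofHom_hom, Spec.map_comp, Category.assoc,
    Scheme.SpecMap_stalkSpecializes_fromSpecStalk, Scheme.SpecMap_stalkMap_fromSpecStalk]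

theorem Nonconstant.isDominant {X Y : Over (Spec (.of K))} [IsCurve X] [IsCurve Y]
    {f : X ⟶ Y} (hf : Nonconstant f) : IsDominant f.left := by
  refine ⟨dense_iff_closure_eq.mpr (Set.univ_subset_iff.mp ?_)⟩
  rw [← genericPoint_closure (α := Y.left)]
  exact closure_mono (Set.singleton_subset_iff.mpr ⟨_, hf.map_genericPoint⟩)

/-- A nonconstant morphism of curves is right cancellable. -/
theorem Nonconstant.hom_ext {X Y Z : Over (Spec (.of K))} [IsCurve X] [IsCurve Y] [IsCurve Z]
    {f : X ⟶ Y} (hf : Nonconstant f) {g g' : Y ⟶ Z} (h : f ≫ g = f ≫ g') : g = g' := by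
  have := hf.isDominant
  have := IsCurve.isProper Z
  exact Over.OverMorphism.ext (ext_of_isDominant_of_isSeparated Z.hom
    ((Over.w g).trans (Over.w g').symm) f.left (congrArg CommaMorphism.left h))

theorem IsCurve.valuationRing_stalk (X : Over (Spec (.of K))) [IsCurve X] (x : X.left) :
    ValuationRing (X.left.presheaf.stalk x) := by
  have := IsCurve.nonsingular x
  exact IsRegularLocalRing.valuationRing_of_ringKrullDim_le_one _
    ((ringKrullDim_stalk_le X.left x).trans_eq IsCurve.dimension_eq_one)

/-- Let `f : X ⟶ Y` be a nonconstant morphism and `h : X ⟶ Z` a morphism of curves. If `h` maps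
`K(Z)` into the image of `K(Y)` in `K(X)`, then `h` factors through `f`. -/
theorem exists_comp_eq {X Y Z : Over (Spec (.of K))} [IsCurve X] [IsCurve Y] [IsCurve Z]
    (f : X ⟶ Y) (hf : Nonconstant f) (h : X ⟶ Z) (hh : Nonconstant h)
    (hr : ∀ a, functionFieldMap h hh a ∈ (functionFieldMap f hf).range) :
    ∃ g : Y ⟶ Z, f ≫ g = h := by
  have := IsCurve.isProper Z
  -- Injectivity of the field map makes these preimages unique, hence additive and multiplicative.
  choose t ht using hr
  have hinj := (functionFieldMap f hf).injective
  let τ : Z.left.functionField →+* Y.left.functionField :=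
    { toFun := t
      map_one' := hinj (by simp [ht])
      map_mul' := fun a b ↦ hinj (by simp [ht])
      map_zero' := hinj (by simp [ht])
      map_add' := fun a b ↦ hinj (by simp [ht]) }
  have hτ : (functionFieldMap f hf).comp τ = functionFieldMap h hh := RingHom.ext ht
  let i := X.left.fromSpecStalk (genericPoint X.left)
  let j := Y.left.fromSpecStalk (genericPoint Y.left)
  let p := Spec.map (CommRingCat.ofHom (functionFieldMap f hf))
  let k := Spec.map (CommRingCat.ofHom τ) ≫ Z.left.fromSpecStalk (genericPoint Z.left)
  have hpj : p ≫ j = i ≫ f.left := SpecMap_functionFieldMap_fromSpecStalk f hf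
  have hpk : p ≫ k = i ≫ h.left := by
    rw [← SpecMap_functionFieldMap_fromSpecStalk h hh, ← hτ, CommRingCat.ofHom_comp, Spec.map_comp,
      Category.assoc]
  have hp : Surjective p := by
    have : Subsingleton (Spec Y.left.functionField) :=
      inferInstanceAs (Subsingleton (PrimeSpectrum Y.left.functionField))
    exact ⟨fun y ↦ ⟨Classical.choice
      (inferInstanceAs (Nonempty (PrimeSpectrum X.left.functionField))), Subsingleton.elim _ _⟩⟩
  -- That `τ` respects `K` is checked after the surjection `p`, where it follows from `f` and `h`
  -- being morphisms over `K`.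
  have hk : k ≫ Z.hom = j ≫ Y.hom := by
    refine ext_of_isDominant p ?_
    rw [← Category.assoc, hpk, ← Category.assoc, hpj, Category.assoc, Category.assoc, Over.w,
      Over.w]
  obtain ⟨g, hg⟩ := exists_hom_of_fromFunctionField Y.hom Z.hom (IsCurve.valuationRing_stalk Y) k hk
  have hgw : g ≫ Z.hom = Y.hom := by
    refine ext_of_isDominant j ?_
    rw [← Category.assoc, hg, hk]
  have hfg : f.left ≫ g = h.left := by
    refine ext_of_isDominant_of_isSeparated Z.hom ?_ i ?_
    · rw [Category.assoc, hgw, Over.w, Over.w]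
    · rw [← Category.assoc, ← hpj, Category.assoc, hg, hpk]
  exact ⟨Over.homMk g hgw, Over.OverMorphism.ext hfg⟩

/-- Otherwise the target would be a single point, of dimension zero. -/
theorem nonconstant_of_iso {X Y : Over (Spec (.of K))} [IsCurve X] [IsCurve Y] (e : X ≅ Y) :
    Nonconstant e.hom := by
  rintro ⟨y, hy⟩
  have h (z : Y.left) : z = y := by
    rw [← hy (e.inv.left z), ← Scheme.Hom.comp_apply, ← Over.comp_left, e.inv_hom_id]
    rfl
  have : Subsingleton Y.left := ⟨fun z z' ↦ (h z).trans (h z').symm⟩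
  have hd := topologicalKrullDim_zero_of_discreteTopology Y.left
  rw [IsCurve.dimension_eq_one] at hd
  exact absurd hd (by decide)

/-- Automorphisms of a composite cover descend to endomorphisms of the intermediate curve if the
monodromy group has a transitive Dedekind subgroup. -/
theorem exists_hom_of_mem_coverAut {C C₁ D : Over (Spec (.of K))} [IsCurve C] [IsCurve C₁]
    [IsCurve D] (θ : C₁ ⟶ D) (ρ : C ⟶ C₁) [hθ : IsCover θ] [hρ : IsCover ρ]
    (hA : MonodromyHasTransitiveDedekindSubgroup (ρ ≫ θ)) {μ : Aut C} (hμ : μ ∈ coverAut (ρ ≫ θ)) :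
    ∃ ν : C₁ ⟶ C₁, ρ ≫ ν = μ.hom ≫ ρ := by
  have hμθ : μ.hom ≫ ρ ≫ θ = ρ ≫ θ := hμ
  have hμ' : Nonconstant μ.hom := nonconstant_of_iso (X := C) (Y := C) μ
  have hψ : IsCover (ρ ≫ θ) := inferInstance
  have hμρ := hμ'.comp hρ.nonconstant
  refine exists_comp_eq ρ hρ.nonconstant (μ.hom ≫ ρ) hμρ fun a ↦ ?_
  let := (functionFieldMap ρ hρ.nonconstant).toAlgebra
  let := (functionFieldMap θ hθ.nonconstant).toAlgebra
  let := (functionFieldMap (ρ ≫ θ) hψ.nonconstant).toAlgebra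
  have : IsScalarTower D.left.functionField C₁.left.functionField C.left.functionField :=
    .of_algebraMap_eq' (functionFieldMap_comp ρ θ hρ.nonconstant hθ.nonconstant hψ.nonconstant)
  have : Algebra.IsSeparable D.left.functionField C.left.functionField := hψ.separable
  let σ : C.left.functionField →ₐ[D.left.functionField] C.left.functionField :=
    { functionFieldMap μ.hom hμ' with
      commutes' := fun a ↦ by
        have h := functionFieldMap_comp μ.hom (ρ ≫ θ) hμ' hψ.nonconstant
          (hμ'.comp hψ.nonconstant)
        simp only [hμθ] at h
        exact (RingHom.congr_fun h a).symm }
  rw [functionFieldMap_comp μ.hom ρ hμ' hρ.nonconstant hμρ]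
  exact FieldExtension.HasTransitiveDedekindSubgroup.map_algebraMap_mem_range hA σ a

end CurveCover

open CurveCover in
theorem theorem1p2 {K : Type u} [Field K] (C C₁ D : Over (Spec (.of K)))
    [IsCurve C] [IsCurve C₁] [IsCurve D] (θ : C₁ ⟶ D) (ρ : C ⟶ C₁) [IsCover θ] [IsCover ρ]
    (hA : MonodromyHasTransitiveDedekindSubgroup (ρ ≫ θ)) :
    (∀ μ ∈ coverAut (ρ ≫ θ), ∃! ν : Aut C₁, ν ∈ coverAut θ ∧ μ.hom ≫ ρ = ρ ≫ ν.hom) ∧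
    ∃ Φ : coverAut (ρ ≫ θ) →* coverAut θ,
      (∀ μ : coverAut (ρ ≫ θ), (μ : Aut C).hom ≫ ρ = ρ ≫ (Φ μ : Aut C₁).hom) ∧
      Φ.ker.map (coverAut (ρ ≫ θ)).subtype = coverAut ρ := by
  have hρ : Nonconstant ρ := IsCover.nonconstant
  have hext {Z : Over (Spec (.of K))} [IsCurve Z] {g g' : C₁ ⟶ Z} : ρ ≫ g = ρ ≫ g' → g = g' :=
    hρ.hom_ext
  have hex : ∀ μ : coverAut (ρ ≫ θ), ∃ ν : coverAut θ,
      (μ : Aut C).hom ≫ ρ = ρ ≫ (ν : Aut C₁).hom := by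
    intro μ
    obtain ⟨a, ha⟩ := exists_hom_of_mem_coverAut θ ρ hA μ.2
    -- The descent of `μ⁻¹` is the inverse of the descent of `μ`, after cancelling `ρ`.
    obtain ⟨b, hb⟩ := exists_hom_of_mem_coverAut θ ρ hA (inv_mem μ.2)
    change ρ ≫ b = (μ : Aut C).inv ≫ ρ at hb
    refine ⟨⟨⟨a, b, hext ?_, hext ?_⟩, hext ?_⟩, ha.symm⟩
    · rw [← Category.assoc, ha, Category.assoc, hb, Category.comp_id]
      exact (μ : Aut C).hom_inv_id_assoc ρ
    · rw [← Category.assoc, hb, Category.assoc, ha, Category.comp_id]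
      exact (μ : Aut C).inv_hom_id_assoc ρ
    · rw [← Category.assoc, ha, Category.assoc]
      exact μ.2
  choose Φ hΦ using hex
  have huniq {ν ν' : coverAut θ} (h : ρ ≫ (ν : Aut C₁).hom = ρ ≫ (ν' : Aut C₁).hom) : ν = ν' :=
    Subtype.ext (Aut.ext (hext h))
  refine ⟨fun μ hμ ↦ ⟨Φ ⟨μ, hμ⟩, ⟨(Φ ⟨μ, hμ⟩).2, hΦ ⟨μ, hμ⟩⟩, fun ν hν ↦
    Aut.ext (hext (hν.2.symm.trans (hΦ ⟨μ, hμ⟩)))⟩, MonoidHom.mk' Φ fun μ μ' ↦ huniq ?_, hΦ, ?_⟩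
  · rw [← hΦ]
    change ((μ' : Aut C).hom ≫ (μ : Aut C).hom) ≫ ρ = ρ ≫ (Φ μ' : Aut C₁).hom ≫ (Φ μ : Aut C₁).hom
    rw [Category.assoc, hΦ, ← Category.assoc, hΦ, Category.assoc]
  · ext μ
    constructor
    · rintro ⟨μ, hμ, rfl⟩
      have h : Φ μ = 1 := hμ
      have := hΦ μ
      rw [h] at this
      exact this.trans (Category.comp_id ρ)
    · intro (hμ : μ.hom ≫ ρ = ρ)
      have hμ' : μ ∈ coverAut (ρ ≫ θ) := by
        change μ.hom ≫ ρ ≫ θ = ρ ≫ θ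
        rw [← Category.assoc, hμ]
      refine ⟨⟨μ, hμ'⟩, huniq ?_, rfl⟩
      exact (hΦ ⟨μ, hμ'⟩).symm.trans (hμ.trans (Category.comp_id ρ).symm)
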